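/- Let $V$ be a finite-dimensional complex vector space with a symplectic (nondegenerate alternating bilinear) form and let $W$ be a complex vector space of dimension $N=2$ with a nondegenerate symmetric bilinear form; put $k=\dim V$. For $i\in\mathrm{Hom}(W,V)$ let $i^*\in\mathrm{Hom}(V,W)$ be its right adjoint, $(w,i^*v)_W=(iw,v)_V$. Let $\mathfrak p=\{X\in\mathfrak{gl}(V)\mid (Xu,v)=(u,Xv)\ \forall u,v\}$, $\mathfrak{sp}(V)=\{X\in\mathfrak{gl}(V)\mid (Xu,v)=-(u,Xv)\ \forall u,v\}$, $\mathbf N=\mathfrak p\oplus\mathfrak p\oplus\mathrm{Hom}(W,V)$, and let $$\mu\colon\mathbf N\to\mathfrak{sp}(V),\qquad \mu(B_1,B_2,i)=[B_1,B_2]+ii^*.$$ Let $m\colon\mathfrak p\times\mathfrak p\to\mathfrak{sp}(V)$, $m(B_1,B_2)=[B_1,B_2]$, and $\rho\colon\mathrm{Hom}(W,V)\to\mathfrak{sp}(V)$, $\rho(i)=ii^*$. Fibres are taken scheme-theoretically. A closed subscheme $Z$ of $\mathbf N$ is called a complete intersection in $\mathbf N$ if its ideal in $\mathbb C[\mathbf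 N]$ can be generated by $\dim\mathbf N-\dim Z$ elements. A point $(B_1,B_2,i)$ is stable if no proper subspace $S\subsetneq V$ satisfies $B_1S\subset S$, $B_2S\subset S$, $\mathrm{Im}\,i\subset S$, and costable if no nonzero subspace $T\subset V$ satisfies $B_1T\subset T$, $B_2T\subset T$, $T\subset\mathrm{Ker}\,i^*$; $\mu^{-1}(0)^{\mathrm{reg}}$ is the set of stable and costable points of $\mu^{-1}(0)$. (1) If $k\ge 2$, then $\mu^{-1}(0)$ is not a complete intersection in $\mathbf N$, and $\mu$ is not flat. Moreover, the closed subscheme $m^{-1}(0)\times\rho^{-1}(0)$ of $\mathbf N$ is contained in $\mu^{-1}(0)$ and has dimension $>\dim\mathbf N-\dim\mathfrak{sp}(V)$. (2) If $k=4$, then $\mu^{-1}(0)^{\mathrm{reg}}=\emptyset$. -/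

import Mathlib

noncomputable section

open Module

/-! ### Affine algebraic geometry of finite-dimensional complex vector spaces -/

section Affine

variable {E F : Type*} [AddCommGroup E] [Module ℂ E] [AddCommGroup F] [Module ℂ F]

/-- The coordinate ring `ℂ[E]` of the affine space `E`: the algebra of functions on `E` generated
by the linear forms. -/
def coordRing (E : Type*) [AddCommGroup E] [Module ℂ E] : Subalgebra ℂ (E → ℂ) :=
  Algebra.adjoin ℂ (Set.range fun l : Dual ℂ E => (l : E → ℂ))

/-- `f` is a morphism of affine spaces: its coordinates are polynomial functions. -/
def IsPolyMap (f : E → F) : Prop :=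
  ∀ l : Dual ℂ F, (fun x => l (f x)) ∈ coordRing E

theorem comp_mem_coordRing {f : E → F} (hf : IsPolyMap f) {g : F → ℂ} (hg : g ∈ coordRing F) :
    (fun x => g (f x)) ∈ coordRing E := by
  unfold coordRing at hg
  induction hg using Algebra.adjoin_induction with
  | mem g hg =>
    obtain ⟨l, rfl⟩ := hg
    exact hf l
  | algebraMap c => exact (coordRing E).algebraMap_mem c
  | add g h _ _ hg hh => exact (coordRing E).add_mem hg hh
  | mul g h _ _ hg hh => exact (coordRing E).mul_mem hg hh

/-- The comorphism `ℂ[F] → ℂ[E]`, `g ↦ g ∘ f`, of a morphism `f : E → F`. -/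
def comorphism (f : E → F) (hf : IsPolyMap f) : coordRing F →ₐ[ℂ] coordRing E where
  toFun g := ⟨fun x => g.1 (f x), comp_mem_coordRing hf g.2⟩
  map_one' := rfl
  map_mul' _ _ := rfl
  map_zero' := rfl
  map_add' _ _ := rfl
  commutes' _ := rfl

/-- The maximal ideal of `ℂ[E]` of the functions vanishing at the point `y`. -/
def pointIdeal (y : E) : Ideal (coordRing E) :=
  RingHom.ker ((Pi.evalRingHom (fun _ : E => ℂ) y).comp (coordRing E).subtype)

/-- The ideal of `ℂ[E]` defining the scheme-theoretic fibre `f⁻¹(y)`. -/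
def fibreIdeal (f : E → F) (hf : IsPolyMap f) (y : F) : Ideal (coordRing E) :=
  (pointIdeal y).map (comorphism f hf)

/-- A morphism of affine spaces is flat if its comorphism is a flat ring homomorphism. -/
def IsFlatMorphism (f : E → F) (hf : IsPolyMap f) : Prop :=
  (comorphism f hf).toRingHom.Flat

/-- The closed subscheme of the affine space `E` defined by `I` is a complete intersection in `E`:
`I` is generated by as many elements as the codimension of the subscheme. -/
def IsCompleteIntersection (I : Ideal (coordRing E)) : Prop :=
  ∃ s : Finset (coordRing E), Ideal.span (s : Set (coordRing E)) = I ∧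
    ringKrullDim (coordRing E ⧸ I) + s.card = ringKrullDim (coordRing E)

/-- Quadratic maps given by a bilinear map are polynomial. -/
theorem isPolyMap_diag [FiniteDimensional ℂ E] {H : Type*} [AddCommGroup H] [Module ℂ H]
    (Q : E →ₗ[ℂ] E →ₗ[ℂ] H) {f : E → F} (j : F →ₗ[ℂ] H) (hj : Function.Injective j)
    (hf : ∀ x, j (f x) = Q x x) : IsPolyMap f := by
  intro l
  obtain ⟨r, hr⟩ := j.exists_leftInverse_of_injective (LinearMap.ker_eq_bot.2 hj)
  have key : (fun x => l (f x)) =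
      ∑ a, (fun x : E => (finBasis ℂ E).coord a x) * (fun x => l (r (Q (finBasis ℂ E a) x))) := by
    funext x
    have h1 : f x = r (Q x x) := by
      rw [← hf x]
      exact (LinearMap.congr_fun hr (f x)).symm
    have h2 : Q x x = ∑ a, (finBasis ℂ E).repr x a • Q (finBasis ℂ E a) x := by
      have h3 : Q x = ∑ a, (finBasis ℂ E).repr x a • Q (finBasis ℂ E a) := by
        conv_lhs => rw [← (finBasis ℂ E).sum_repr x, map_sum]
        simp only [map_smul]
      rw [h3]
      simp
    rw [h1, h2]
    simp [Finset.sum_apply]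
  rw [key]
  refine Subalgebra.sum_mem _ fun a _ => Subalgebra.mul_mem _ ?_ ?_
  · exact Algebra.subset_adjoin ⟨(finBasis ℂ E).coord a, rfl⟩
  · exact Algebra.subset_adjoin ⟨l ∘ₗ r ∘ₗ Q (finBasis ℂ E a), rfl⟩

end Affine

/-! ### Adjoints -/

section Adjoint

variable {V₁ V₂ : Type*} [AddCommGroup V₁] [Module ℂ V₁] [AddCommGroup V₂] [Module ℂ V₂]
  [FiniteDimensional ℂ V₁]

/-- The right adjoint `i ↦ i*`, `Hom(V₁, V₂) → Hom(V₂, V₁)`, with respect to a nondegenerate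
bilinear form `b₁` on `V₁` and a bilinear form `b₂` on `V₂`. -/
def rightAdjoint (b₁ : LinearMap.BilinForm ℂ V₁) (h₁ : b₁.Nondegenerate)
    (b₂ : LinearMap.BilinForm ℂ V₂) : (V₁ →ₗ[ℂ] V₂) →ₗ[ℂ] (V₂ →ₗ[ℂ] V₁) where
  toFun i :=
    (LinearMap.BilinForm.toDual b₁.flip
      (LinearMap.BilinForm.Nondegenerate.flip h₁)).symm.toLinearMap ∘ₗ i.dualMap ∘ₗ b₂.flip
  map_add' i i' := by
    ext w
    simp only [LinearMap.comp_apply, LinearMap.add_apply, ← map_add]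
    congr 1
    ext v
    simp
  map_smul' c i := by
    ext w
    simp only [LinearMap.comp_apply, LinearMap.smul_apply, ← map_smul, RingHom.id_apply]
    congr 1
    ext v
    simp

/-- The defining property `(v, i* w) = (i v, w)`. -/
theorem apply_rightAdjoint (b₁ : LinearMap.BilinForm ℂ V₁) (h₁ : b₁.Nondegenerate)
    (b₂ : LinearMap.BilinForm ℂ V₂) (i : V₁ →ₗ[ℂ] V₂) (v : V₁) (w : V₂) :
    b₁ v (rightAdjoint b₁ h₁ b₂ i w) = b₂ (i v) w := by
  exact LinearMap.BilinForm.apply_toDual_symm_apply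
    (hB := LinearMap.BilinForm.Nondegenerate.flip h₁) (i.dualMap (b₂.flip w)) v

end Adjoint

/-! ### ADHM data with a symplectic `V` and an orthogonal `W` -/

/-- A symplectic form on `V` and an orthogonal (nondegenerate symmetric) form on `W`. -/
structure SOForms (V W : Type*) [AddCommGroup V] [Module ℂ V] [AddCommGroup W] [Module ℂ W] where
  /-- the form on `V` -/
  formV : LinearMap.BilinForm ℂ V
  /-- the form on `W` -/
  formW : LinearMap.BilinForm ℂ W
  alt : formV.IsAlt
  nondegV : formV.Nondegenerate
  symm : formW.IsSymm
  nondegW : formW.Nondegenerate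

namespace SOForms

variable {V W : Type*} [AddCommGroup V] [Module ℂ V]
  [AddCommGroup W] [Module ℂ W] (Φ : SOForms V W)

/-- `𝔭(V) = {X ∈ 𝔤𝔩(V) | (Xu, v) = (u, Xv)}`. -/
abbrev p : Submodule ℂ (End ℂ V) := Φ.formV.selfAdjointSubmodule

/-- `𝔰𝔭(V) = {X ∈ 𝔤𝔩(V) | (Xu, v) = -(u, Xv)}`, the Lie algebra of `Sp(V)`. -/
abbrev sp : Submodule ℂ (End ℂ V) := Φ.formV.skewAdjointSubmodule

/-- `𝐍 = 𝔭(V) ⊕ 𝔭(V) ⊕ Hom(W, V)`; the triple `(B₁, B₂, i)` stands for the ADHM quiver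
representation `(B₁, B₂, i, i*)`. -/
abbrev N : Type _ := Φ.p × Φ.p × (W →ₗ[ℂ] V)

theorem commutator_mem (B₁ B₂ : Φ.p) : (⁅(B₁ : End ℂ V), (B₂ : End ℂ V)⁆ : End ℂ V) ∈ Φ.sp := by
  have h₁ : ∀ u v, Φ.formV (B₁.1 u) v = Φ.formV u (B₁.1 v) :=
    (LinearMap.mem_selfAdjointSubmodule _).1 B₁.2
  have h₂ : ∀ u v, Φ.formV (B₂.1 u) v = Φ.formV u (B₂.1 v) :=
    (LinearMap.mem_selfAdjointSubmodule _).1 B₂.2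
  rw [LinearMap.mem_skewAdjointSubmodule]
  intro u v
  simp [Ring.lie_def, h₁, h₂]

variable [FiniteDimensional ℂ W]

/-- The adjoint `i* ∈ Hom(V, W)` of `i ∈ Hom(W, V)`. -/
abbrev star : (W →ₗ[ℂ] V) →ₗ[ℂ] (V →ₗ[ℂ] W) := rightAdjoint Φ.formW Φ.nondegW Φ.formV

theorem comp_star_mem (i : W →ₗ[ℂ] V) : (i ∘ₗ Φ.star i : End ℂ V) ∈ Φ.sp := by
  have h : ∀ w v, Φ.formW w (Φ.star i v) = Φ.formV (i w) v :=
    apply_rightAdjoint Φ.formW Φ.nondegW Φ.formV i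
  have ha : ∀ u v, Φ.formV u v = -Φ.formV v u := fun u v => (Φ.alt.neg_eq v u).symm
  rw [LinearMap.mem_skewAdjointSubmodule]
  intro u v
  simp only [LinearMap.comp_apply, Pi.neg_apply, map_neg]
  rw [← h, ha u, neg_neg, ← h, Φ.symm.eq]

/-- The commutator map `m : 𝔭 × 𝔭 → 𝔰𝔭(V)`, `(B₁, B₂) ↦ [B₁, B₂]`. -/
def m (x : Φ.p × Φ.p) : Φ.sp := ⟨⁅(x.1 : End ℂ V), (x.2 : End ℂ V)⁆, Φ.commutator_mem x.1 x.2⟩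

/-- The map `ρ : Hom(W, V) → 𝔰𝔭(V)`, `i ↦ i i*`. -/
def rho (i : W →ₗ[ℂ] V) : Φ.sp := ⟨i ∘ₗ Φ.star i, Φ.comp_star_mem i⟩

/-- The moment map `μ : 𝐍 → 𝔰𝔭(V)`, `(B₁, B₂, i, i*) ↦ [B₁, B₂] + i i*`. -/
def mu (x : Φ.N) : Φ.sp := Φ.m (x.1, x.2.1) + Φ.rho x.2.2

/-- The map `(B₁, B₂, i) ↦ ([B₁, B₂], i i*)`, whose fibre over `0` is `m⁻¹(0) × ρ⁻¹(0)`. -/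
def mrho (x : Φ.N) : Φ.sp × Φ.sp := (Φ.m (x.1, x.2.1), Φ.rho x.2.2)

/-- The bilinear map whose diagonal is the commutator map. -/
def mBilin : Φ.N →ₗ[ℂ] Φ.N →ₗ[ℂ] End ℂ V :=
  LinearMap.mk₂ ℂ (fun x y => ⁅(x.1 : End ℂ V), (y.2.1 : End ℂ V)⁆)
    (fun _ _ _ => by simp [Ring.lie_def, add_mul, mul_add]; abel)
    (fun _ _ _ => by simp [Ring.lie_def, smul_sub])
    (fun _ _ _ => by simp [Ring.lie_def, add_mul, mul_add]; abel)
    (fun _ _ _ => by simp [Ring.lie_def, smul_sub])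

/-- The bilinear map whose diagonal is `i ↦ i i*`. -/
def rhoBilin : Φ.N →ₗ[ℂ] Φ.N →ₗ[ℂ] End ℂ V :=
  LinearMap.mk₂ ℂ (fun x y => x.2.2 ∘ₗ Φ.star y.2.2)
    (fun _ _ _ => by simp [LinearMap.add_comp]) (fun _ _ _ => by simp [LinearMap.smul_comp])
    (fun _ _ _ => by simp [LinearMap.comp_add]) (fun _ _ _ => by simp [LinearMap.comp_smul])

variable [FiniteDimensional ℂ V]

theorem isPolyMap_mu : IsPolyMap Φ.mu :=
  isPolyMap_diag (Φ.mBilin + Φ.rhoBilin) Φ.sp.subtype Φ.sp.injective_subtype fun _ => rfl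

theorem isPolyMap_mrho : IsPolyMap Φ.mrho :=
  isPolyMap_diag
    (Φ.mBilin.compr₂ (LinearMap.inl ℂ (End ℂ V) (End ℂ V)) +
      Φ.rhoBilin.compr₂ (LinearMap.inr ℂ (End ℂ V) (End ℂ V)))
    (Φ.sp.subtype.prodMap Φ.sp.subtype)
    (Φ.sp.injective_subtype.prodMap Φ.sp.injective_subtype) fun _ => by
      ext1 <;> simp [mrho, m, rho, mBilin, rhoBilin]

/-- The ideal of `ℂ[𝐍]` defining the closed subscheme `μ⁻¹(0)` of `𝐍`. -/
def muIdeal : Ideal (coordRing Φ.N) := fibreIdeal Φ.mu Φ.isPolyMap_mu 0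

/-- The ideal of `ℂ[𝐍]` defining the closed subscheme `m⁻¹(0) × ρ⁻¹(0)` of `𝐍`. -/
def mrhoIdeal : Ideal (coordRing Φ.N) := fibreIdeal Φ.mrho Φ.isPolyMap_mrho 0

end SOForms

/-! ### Stability -/

section Stability

variable {V W : Type*} [AddCommGroup V] [Module ℂ V] [AddCommGroup W] [Module ℂ W]

/-- No proper subspace of `V` is stable under `B₁, B₂` and contains the image of `i`. -/
def IsStable (B₁ B₂ : End ℂ V) (i : W →ₗ[ℂ] V) : Prop :=
  ¬ ∃ S : Submodule ℂ V, S ≠ ⊤ ∧ S.map B₁ ≤ S ∧ S.map B₂ ≤ S ∧ LinearMap.range i ≤ S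

/-- No nonzero subspace of `V` is stable under `B₁, B₂` and contained in the kernel of `j`. -/
def IsCostable (B₁ B₂ : End ℂ V) (j : V →ₗ[ℂ] W) : Prop :=
  ¬ ∃ T : Submodule ℂ V, T ≠ ⊥ ∧ T.map B₁ ≤ T ∧ T.map B₂ ≤ T ∧ T ≤ LinearMap.ker j

/-- The regular locus `μ⁻¹(0)^reg` of the stable and costable points of `μ⁻¹(0)`. -/
def SOForms.regularLocus [FiniteDimensional ℂ W] (Φ : SOForms V W) :
    Set Φ.N :=
  {x | Φ.mu x = 0 ∧ IsStable (x.1 : End ℂ V) (x.2.1 : End ℂ V) x.2.2 ∧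
    IsCostable (x.1 : End ℂ V) (x.2.1 : End ℂ V) (Φ.star x.2.2)}

end Stability

end

noncomputable section

open Module

/-! ### Coordinate rings, dimension bounds, and zero fibres of quadratic maps. -/

section Geometry

variable {E F : Type*} [AddCommGroup E] [Module ℂ E] [AddCommGroup F] [Module ℂ F]

/-! Part (1) rests on one large linear subspace. For an isotropic $u\in W$ let $L$ be the set of
$(B, c\cdot 1, (u,\cdot)a)$ with $B\in\mathfrak p$, $c\in\mathbb C$, $a\in V$. Both $[B,c]$ and
$ii^*=(u,u)\,a^2$ vanish, so $L$ lies in $m^{-1}(0)\times\rho^{-1}(0)$. Now $\dim L=\dim\mathfrak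
p+1+k$ and $\dim\mathbf N=2\dim\mathfrak p+2k$, while $\dim\mathfrak{sp}(V)\ge\dim\mathfrak p+k$
(`finrank_p_add_le`); hence $\dim L>\dim\mathbf N-\dim\mathfrak{sp}(V)$. Flatness would bound
heights under contraction by going-down, which fails at the generic point of $L$ lying over the
origin (`finrank_add_finrank_le_of_isFlatMorphism`). For complete intersections, the components of
$\mu$ are linearly independent quadrics, so the ideal needs at least $\dim\mathfrak{sp}(V)$
generators (`finrank_le_card_of_span_eq_fibreIdeal`), more than $\dim\mathbf N-\dim\mu^{-1}(0)$.

For part (2), when $k=4$ the Pfaffian Cayley-Hamilton identity makes every $X\in\mathfrak p$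
quadratic over the scalars. After scalar shifts $P^2=c$, $Q^2=d$ and $PQ+QP=s$, so
$[P,Q]^2=s^2-4cd$. Since $[P,Q]=-ii^*$ has a kernel ($2<4$), the discriminant is zero, and the span
of $P,Q$ contains a square-zero $Z$ anticommuting with the other generator. An invariant proper
subspace containing $\mathrm{Im}\,i$ can then be written down (`exists_invariant_of_anticommute`),
so stability already fails. -/

theorem dual_mem_coordRing (l : Dual ℂ E) : (l : E → ℂ) ∈ coordRing E :=
  Algebra.subset_adjoin ⟨l, rfl⟩

/-- A linear form as an element of the coordinate ring. -/
def linearForm (l : Dual ℂ E) : coordRing E := ⟨l, dual_mem_coordRing l⟩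

theorem isPolyMap_linear (f : E →ₗ[ℂ] F) : IsPolyMap f := fun l => dual_mem_coordRing (l ∘ₗ f)

theorem coordRing_continuous_line (g : coordRing E) (x : E) :
    Continuous fun t : ℂ => g.1 (t • x) := by
  obtain ⟨g, hg⟩ := g
  change Continuous fun t : ℂ => g (t • x)
  unfold coordRing at hg
  induction hg using Algebra.adjoin_induction with
  | mem g hg =>
    obtain ⟨l, rfl⟩ := hg
    simp only [map_smul, smul_eq_mul]
    fun_prop
  | algebraMap c => exact continuous_const
  | add g h _ _ hg hh => exact hg.add hh
  | mul g h _ _ hg hh => exact hg.mul hh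

/-- The ideal of functions vanishing on a linear subspace. -/
def subspaceIdeal (L : Submodule ℂ E) : Ideal (coordRing E) :=
  RingHom.ker (comorphism L.subtype (isPolyMap_linear L.subtype))

theorem mem_subspaceIdeal {L : Submodule ℂ E} {g : coordRing E} :
    g ∈ subspaceIdeal L ↔ ∀ x ∈ L, g.1 x = 0 := by
  rw [subspaceIdeal, RingHom.mem_ker]
  constructor
  · intro h x hx
    exact congrArg (fun g => g.1 ⟨x, hx⟩) h
  · intro h
    refine Subtype.ext (funext fun x => h x x.2)

theorem subspaceIdeal_strictAnti : StrictAnti (subspaceIdeal (E := E)) := by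
  intro L M h
  refine lt_of_le_of_ne (fun g hg => ?_) fun he => ?_
  · rw [mem_subspaceIdeal] at *
    exact fun x hx => hg x (h.le hx)
  · obtain ⟨x, hxM, hxL⟩ := SetLike.exists_of_lt h
    obtain ⟨l, hl, hlL⟩ := Submodule.exists_le_ker_of_notMem hxL
    have h1 : linearForm l ∈ subspaceIdeal L :=
      mem_subspaceIdeal.2 fun y hy => hlL hy
    rw [← he, mem_subspaceIdeal] at h1
    exact hl (h1 x hxM)

section FiniteDimensional

variable [FiniteDimensional ℂ E]

variable (E) in
/-- The coordinate ring as the image of a polynomial ring. -/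
def coordRingOfMvPolynomial : MvPolynomial (Fin (finrank ℂ E)) ℂ →ₐ[ℂ] coordRing E :=
  MvPolynomial.aeval fun a => linearForm ((finBasis ℂ E).coord a)

theorem coordRingOfMvPolynomial_apply (q : MvPolynomial (Fin (finrank ℂ E)) ℂ) (x : E) :
    (coordRingOfMvPolynomial E q).1 x = MvPolynomial.eval ((finBasis ℂ E).repr x) q := by
  induction q using MvPolynomial.induction_on with
  | C a => simp [coordRingOfMvPolynomial]
  | add q r hq hr => simp_all
  | mul_X q a hq =>
    rw [map_mul, map_mul, MvPolynomial.eval_X, ← hq]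
    simp [coordRingOfMvPolynomial, linearForm]

theorem coordRingOfMvPolynomial_surjective :
    Function.Surjective (coordRingOfMvPolynomial E) := by
  rintro ⟨g, hg⟩
  suffices h : g ∈ ((coordRing E).val.comp (coordRingOfMvPolynomial E)).range by
    obtain ⟨q, hq⟩ := h
    exact ⟨q, Subtype.ext hq⟩
  refine (Algebra.adjoin_le (S := AlgHom.range _) ?_) hg
  rintro _ ⟨l, rfl⟩
  refine ⟨∑ a, MvPolynomial.C (l (finBasis ℂ E a)) * MvPolynomial.X a, ?_⟩
  funext x
  change (coordRingOfMvPolynomial E _).1 x = l x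
  rw [coordRingOfMvPolynomial_apply]
  conv_rhs => rw [← (finBasis ℂ E).sum_repr x, map_sum]
  simp [mul_comm]

theorem coordRingOfMvPolynomial_injective :
    Function.Injective (coordRingOfMvPolynomial E) := by
  intro q r h
  refine MvPolynomial.funext fun x => ?_
  have h1 := congrArg (fun g => g.1 ((finBasis ℂ E).equivFun.symm x)) h
  simp only [coordRingOfMvPolynomial_apply] at h1
  have h2 : ⇑((finBasis ℂ E).repr ((finBasis ℂ E).equivFun.symm x)) = x :=
    (finBasis ℂ E).equivFun.apply_symm_apply x
  rwa [h2] at h1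

instance : IsDomain (coordRing E) :=
  (AlgEquiv.ofBijective (coordRingOfMvPolynomial E)
    ⟨coordRingOfMvPolynomial_injective, coordRingOfMvPolynomial_surjective⟩).symm.toMulEquiv.isDomain

theorem ringKrullDim_coordRing : ringKrullDim (coordRing E) = finrank ℂ E := by
  rw [← ringKrullDim_eq_of_ringEquiv (AlgEquiv.ofBijective (coordRingOfMvPolynomial E)
    ⟨coordRingOfMvPolynomial_injective, coordRingOfMvPolynomial_surjective⟩).toRingEquiv,
    MvPolynomial.ringKrullDim_of_isNoetherianRing]
  simp

instance (L : Submodule ℂ E) : (subspaceIdeal L).IsPrime := RingHom.ker_isPrime _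

variable (E) in
/-- The strictly monotone map sending a subspace to the generic point of it. -/
def subspacePrime (L : (Submodule ℂ E)ᵒᵈ) : PrimeSpectrum (coordRing E) :=
  ⟨subspaceIdeal (OrderDual.ofDual L), inferInstance⟩

theorem subspacePrime_strictMono : StrictMono (subspacePrime E) := fun _ _ h =>
  subspaceIdeal_strictAnti (E := E) h

theorem krullDim_submodule : Order.krullDim (Submodule ℂ E) = finrank ℂ E := by
  rw [← Module.coe_length, Module.length_eq_finrank]
  rfl

/-- A full flag of linear subspaces gives a chain of primes below the ideal of the origin. In the
order dual the zero subspace is the top element. -/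
theorem finrank_le_height_subspacePrime_bot :
    (finrank ℂ E : ℕ∞) ≤ Order.height (subspacePrime E (OrderDual.toDual ⊥)) := by
  refine le_trans ?_ (Order.height_le_height_apply_of_strictMono _ subspacePrime_strictMono _)
  have h := Order.height_top_eq_krullDim (α := (Submodule ℂ E)ᵒᵈ)
  rw [Order.krullDim_orderDual, krullDim_submodule] at h
  exact (WithBot.coe_le_coe.1 h.ge)

/-- A closed subscheme containing a linear subspace has at least its dimension. -/
theorem finrank_le_ringKrullDim_quotient {I : Ideal (coordRing E)} {L : Submodule ℂ E}
    (h : I ≤ subspaceIdeal L) : (finrank ℂ L : WithBot ℕ∞) ≤ ringKrullDim (coordRing E ⧸ I) := by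
  rw [← ringKrullDim_coordRing]
  refine ringKrullDim_le_of_surjective
    (Ideal.Quotient.lift I (comorphism L.subtype (isPolyMap_linear L.subtype)).toRingHom h) ?_
  refine Ideal.Quotient.lift_surjective_of_surjective _ _ ?_
  obtain ⟨r, hr⟩ := L.subtype.exists_leftInverse_of_injective L.ker_subtype
  intro g
  refine ⟨comorphism r (isPolyMap_linear r) g, Subtype.ext (funext fun x => ?_)⟩
  exact congrArg g.1 (LinearMap.congr_fun hr x)

/-- The dimension of the quotient is the coheight of the prime, and height plus coheight never
exceeds the dimension. Equality is not needed. -/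
theorem ringKrullDim_quotient_add_height_le (p : PrimeSpectrum (coordRing E)) :
    ringKrullDim (coordRing E ⧸ p.asIdeal) + Order.height p ≤ finrank ℂ E := by
  have h1 : ringKrullDim (coordRing E ⧸ p.asIdeal) = Order.coheight p := by
    rw [ringKrullDim_quotient, Order.coheight_eq_krullDim_Ici]
    rfl
  rw [h1, ← ringKrullDim_coordRing, ringKrullDim,
    Order.krullDim_eq_iSup_height_add_coheight_of_nonempty, ← WithBot.coe_add, add_comm]
  exact WithBot.coe_le_coe.2 (le_iSup (fun p => Order.height p + Order.coheight p) p)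

end FiniteDimensional

/-- Flat maps have going-down: a chain of primes ending at the contraction of `P` lifts to a chain
of the same length ending at `P`. -/
theorem height_le_height_of_flat {R S : Type*} [CommRing R] [CommRing S] {f : R →+* S}
    (hf : f.Flat) (P : PrimeSpectrum S) :
    Order.height (PrimeSpectrum.comap f P) ≤ Order.height P := by
  algebraize [f]
  refine Order.height_le fun l hl => ?_
  have : P.asIdeal.LiesOver l.last.asIdeal := ⟨by rw [hl]; rfl⟩
  obtain ⟨M, hM, hP, -⟩ := Ideal.exists_ltSeries_of_hasGoingDown l P.asIdeal
  rw [← hM]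
  refine Order.length_le_height hP.le

/-- The fibre of a flat morphism contains no linear subspace of dimension larger than expected. -/
theorem finrank_add_finrank_le_of_isFlatMorphism [FiniteDimensional ℂ E] [FiniteDimensional ℂ F]
    {f : E → F} {hf : IsPolyMap f} (h : IsFlatMorphism f hf) {L : Submodule ℂ E}
    (hL : ∀ x ∈ L, f x = 0) : finrank ℂ L + finrank ℂ F ≤ finrank ℂ E := by
  have h1 := height_le_height_of_flat h (subspacePrime E (OrderDual.toDual L))
  -- On `L` the function `g ∘ f` is constantly `g 0`, so the generic point of `L` maps to the
  -- origin.
  have h2 : PrimeSpectrum.comap (comorphism f hf).toRingHom (subspacePrime E (OrderDual.toDual L)) =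
      subspacePrime F (OrderDual.toDual ⊥) := by
    ext g
    change comorphism f hf g ∈ subspaceIdeal L ↔ g ∈ subspaceIdeal ⊥
    rw [mem_subspaceIdeal, mem_subspaceIdeal]
    constructor
    · intro hg x hx
      rw [(Submodule.mem_bot ℂ).1 hx, ← hL 0 L.zero_mem]
      exact hg 0 L.zero_mem
    · intro hg x hx
      change g.1 (f x) = 0
      rw [hL x hx]
      exact hg 0 rfl
  rw [h2] at h1
  have h3 := (add_le_add (finrank_le_ringKrullDim_quotient (le_refl (subspaceIdeal L)))
    (WithBot.coe_le_coe.2 (finrank_le_height_subspacePrime_bot.trans h1))).trans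
    (ringKrullDim_quotient_add_height_le (subspacePrime E (OrderDual.toDual L)))
  exact_mod_cast h3

/-- First-order expansion along a line. Continuity of the remainder is what later permits evaluation
at `t = 0` after cancelling powers of `t`. -/
theorem exists_eq_add_mul_along_line (g : coordRing E) (x : E) :
    ∃ G : ℂ → ℂ, Continuous G ∧ ∀ t : ℂ, g.1 (t • x) = g.1 0 + t * G t := by
  obtain ⟨g, hg⟩ := g
  change ∃ G : ℂ → ℂ, Continuous G ∧ ∀ t : ℂ, g (t • x) = g 0 + t * G t
  unfold coordRing at hg
  induction hg using Algebra.adjoin_induction with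
  | mem g hg =>
    obtain ⟨l, rfl⟩ := hg
    exact ⟨fun _ => l x, continuous_const, fun t => by simp⟩
  | algebraMap c => exact ⟨0, continuous_const, fun t => by simp [Pi.algebraMap_apply]⟩
  | add g h _ _ hg hh =>
    obtain ⟨G, hG, hg⟩ := hg
    obtain ⟨H, hH, hh⟩ := hh
    refine ⟨G + H, hG.add hH, fun t => ?_⟩
    simp only [Pi.add_apply, hg, hh]
    ring
  | mul g h _ _ hg hh =>
    obtain ⟨G, hG, hg⟩ := hg
    obtain ⟨H, hH, hh⟩ := hh
    refine ⟨fun t => g 0 * H t + G t * h 0 + t * G t * H t, by fun_prop, fun t => ?_⟩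
    simp only [Pi.mul_apply, hg, hh]
    ring

/-- Functions in the fibre ideal of a quadratic map vanish to second order along lines. -/
theorem exists_eq_sq_mul_of_mem_fibreIdeal {f : E → F} {hf : IsPolyMap f}
    (hq : ∀ (t : ℂ) x, f (t • x) = t ^ 2 • f x) {g : coordRing E} (hg : g ∈ fibreIdeal f hf 0)
    (x : E) : ∃ G : ℂ → ℂ, Continuous G ∧ ∀ t : ℂ, g.1 (t • x) = t ^ 2 * G t := by
  unfold fibreIdeal Ideal.map at hg
  induction hg using Submodule.span_induction with
  | mem g hg =>
    obtain ⟨g₀, hg₀, rfl⟩ := hg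
    obtain ⟨G, hG, h⟩ := exists_eq_add_mul_along_line g₀ (f x)
    refine ⟨fun t => G (t ^ 2), by fun_prop, fun t => ?_⟩
    change g₀.1 (f (t • x)) = _
    have h0 : g₀.1 0 = 0 := hg₀
    rw [hq, h, h0, zero_add]
  | zero => exact ⟨0, continuous_const, fun t => by simp⟩
  | add g h _ _ hg hh =>
    obtain ⟨G, hG, hg⟩ := hg
    obtain ⟨H, hH, hh⟩ := hh
    refine ⟨G + H, hG.add hH, fun t => ?_⟩
    have : (g + h).1 (t • x) = g.1 (t • x) + h.1 (t • x) := rfl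
    rw [this, hg, hh, Pi.add_apply]
    ring
  | smul a g _ hg =>
    obtain ⟨G, hG, hg⟩ := hg
    refine ⟨fun t => a.1 (t • x) * G t, (coordRing_continuous_line a x).mul hG, fun t => ?_⟩
    have : (a • g).1 (t • x) = a.1 (t • x) * g.1 (t • x) := rfl
    rw [this, hg]
    ring

/-- If no nonzero linear form is annihilated by a quadratic map, the ideal of its zero fibre needs
as many generators as there are equations. -/
theorem finrank_le_card_of_span_eq_fibreIdeal [FiniteDimensional ℂ F] {f : E → F} {hf : IsPolyMap f}
    (hq : ∀ (t : ℂ) x, f (t • x) = t ^ 2 • f x)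
    (hl : ∀ l : Dual ℂ F, (∀ x, l (f x) = 0) → l = 0)
    {s : Finset (coordRing E)} (hs : Ideal.span (s : Set (coordRing E)) = fibreIdeal f hf 0) :
    finrank ℂ F ≤ s.card := by
  have hmem : ∀ j, ∃ h : coordRing E → coordRing E,
      ∑ a ∈ s, h a • a = comorphism f hf (linearForm ((finBasis ℂ F).coord j)) := fun j => by
    have h1 : comorphism f hf (linearForm ((finBasis ℂ F).coord j)) ∈
        Ideal.span (s : Set (coordRing E)) := by
      rw [hs]
      exact Ideal.mem_map_of_mem _ (map_zero ((finBasis ℂ F).coord j))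
    obtain ⟨h, -, hh⟩ := Submodule.mem_span_finset.1 h1
    exact ⟨h, hh⟩
  choose h hh using hmem
  -- `A` holds the constant terms of the coefficients expressing the equations through the
  -- generators. If its rows are independent, there are at least as many generators as equations.
  let A : Matrix (Fin (finrank ℂ F)) s ℂ := fun j a => (h j a).1 0
  have hinj : Function.Injective A.vecMulLinear := by
    rw [← LinearMap.ker_eq_bot, LinearMap.ker_eq_bot']
    intro c hc
    have hc' : ∀ a ∈ s, ∑ j, c j * (h j a).1 0 = 0 := fun a ha => congrFun hc ⟨a, ha⟩
    have hl0 : ∑ j, c j • (finBasis ℂ F).coord j = 0 := by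
      refine hl _ fun x => ?_
      have hG : ∀ a, ∃ G : ℂ → ℂ, a ∈ s → Continuous G ∧ ∀ t : ℂ, a.1 (t • x) = t ^ 2 * G t := by
        intro a
        by_cases ha : a ∈ s
        · obtain ⟨G, hG⟩ := exists_eq_sq_mul_of_mem_fibreIdeal (hf := hf) hq
            (hs ▸ Ideal.subset_span ha) x
          exact ⟨G, fun _ => hG⟩
        · exact ⟨0, fun h => absurd h ha⟩
      choose G hG using hG
      -- Both sides compute the combination of equations with weights `c` at `t • x`: the left by
      -- homogeneity, the right through the generators, each divisible by `t ^ 2`.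
      have key : ∀ t : ℂ, t ^ 2 * (∑ j, c j • (finBasis ℂ F).coord j) (f x) =
          t ^ 2 * ∑ a ∈ s, (∑ j, c j * (h j a).1 (t • x)) * G a t := by
        intro t
        have h1 : ∀ j, t ^ 2 * (finBasis ℂ F).coord j (f x) =
            ∑ a ∈ s, (h j a).1 (t • x) * (t ^ 2 * G a t) := fun j => by
          have h2 := congrArg (fun g => g.1 (t • x)) (hh j)
          have h3 : (comorphism f hf (linearForm ((finBasis ℂ F).coord j))).1 (t • x) =
            t ^ 2 * (finBasis ℂ F).coord j (f x) := by
            change (finBasis ℂ F).coord j (f (t • x)) = _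
            rw [hq, map_smul, smul_eq_mul]
          rw [← h3, ← h2]
          simp only [AddSubmonoidClass.coe_finsetSum, Finset.sum_apply]
          refine Finset.sum_congr rfl fun a ha => ?_
          rw [← (hG a ha).2]
          rfl
        rw [LinearMap.sum_apply, Finset.mul_sum]
        simp only [LinearMap.smul_apply, smul_eq_mul]
        simp only [mul_left_comm (t ^ 2), h1, Finset.mul_sum, Finset.sum_mul]
        rw [Finset.sum_comm]
        refine Finset.sum_congr rfl fun a _ => Finset.sum_congr rfl fun j _ => ?_
        ring
      have hcont : Continuous fun t : ℂ => ∑ a ∈ s, (∑ j, c j * (h j a).1 (t • x)) * G a t := by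
        refine continuous_finsetSum _ fun a ha => Continuous.mul ?_ (hG a ha).1
        exact continuous_finsetSum _ fun j _ =>
          continuous_const.mul (coordRing_continuous_line (h j a) x)
      -- Cancel `t ^ 2` for `t ≠ 0` and extend by continuity. At `t = 0` the coefficients vanish
      -- because `c` is in the kernel of `A`.
      have heq := Continuous.ext_on (dense_compl_singleton (0 : ℂ))
        (continuous_const (y := (∑ j, c j • (finBasis ℂ F).coord j) (f x))) hcont
        fun t ht => mul_left_cancel₀ (pow_ne_zero 2 ht) (key t)
      refine (congrFun heq 0).trans (Finset.sum_eq_zero fun a ha => ?_)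
      rw [zero_smul, hc' a ha, zero_mul]
    funext j
    have h1 := LinearMap.congr_fun hl0 (finBasis ℂ F j)
    simpa [Finsupp.single_apply] using h1
  simpa using LinearMap.finrank_le_finrank_of_injective hinj

end Geometry

/-! ### Symplectic linear algebra and the large linear subspace of the zero fibre. -/

namespace SOForms

variable {V W : Type*} [AddCommGroup V] [Module ℂ V] [AddCommGroup W] [Module ℂ W]
  (Φ : SOForms V W)

theorem p_apply (X : Φ.p) (u v : V) : Φ.formV (X.1 u) v = Φ.formV u (X.1 v) :=
  (LinearMap.mem_selfAdjointSubmodule _).1 X.2 u v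

theorem sp_apply (X : Φ.sp) (u v : V) : Φ.formV (X.1 u) v = -Φ.formV u (X.1 v) :=
  ((LinearMap.mem_skewAdjointSubmodule _).1 X.2 u v).trans (map_neg _ _)

theorem formV_swap (u v : V) : Φ.formV u v = -Φ.formV v u := (Φ.alt.neg_eq v u).symm

/-- The rank one map `w ↦ (u, w) v`. -/
def rankOne (u : W) : V →ₗ[ℂ] (W →ₗ[ℂ] V) := LinearMap.smulRightₗ (Φ.formW u)

theorem rankOne_apply (u : W) (v : V) (w : W) : Φ.rankOne u v w = Φ.formW u w • v := rfl

/-- `a² ∈ S²V ≅ 𝔰𝔭(V)`. -/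
def square (a : V) : Φ.sp :=
  ⟨LinearMap.toSpanSingleton ℂ V a ∘ₗ Φ.formV a, by
    rw [LinearMap.mem_skewAdjointSubmodule]
    intro u v
    simp [← Φ.alt.neg_eq u a, mul_comm]⟩

theorem square_apply (a v : V) : (Φ.square a : End ℂ V) v = Φ.formV a v • a := rfl

theorem exists_formW_self_ne_zero [Nontrivial W] : ∃ u, Φ.formW u u ≠ 0 := by
  refine LinearMap.BilinForm.exists_bilinForm_self_ne_zero ?_ ⟨fun x y => Φ.symm.eq x y⟩
  rintro h
  obtain ⟨u, hu⟩ := exists_ne (0 : W)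
  exact hu (Φ.nondegW.1 u fun w => by rw [h]; rfl)

theorem exists_isotropic (hW : 2 ≤ finrank ℂ W) : ∃ u, u ≠ 0 ∧ Φ.formW u u = 0 := by
  have : Nontrivial W := Module.nontrivial_of_finrank_pos (R := ℂ) (by omega)
  obtain ⟨x, hx⟩ := exists_ne (0 : W)
  obtain ⟨y, hxy⟩ := exists_linearIndependent_pair_of_one_lt_finrank (R := ℂ) hW hx
  rw [LinearIndependent.pair_iff] at hxy
  by_cases hy : Φ.formW y y = 0
  · exact ⟨y, fun h => one_ne_zero (hxy 0 1 (by simp [h])).2, hy⟩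
  -- Quadratic formula for an isotropic vector in the plane spanned by `x` and `y`, with `s` a
  -- square root of the discriminant.
  obtain ⟨s, hs⟩ := IsAlgClosed.exists_pow_nat_eq
    (Φ.formW x y ^ 2 - Φ.formW x x * Φ.formW y y) (n := 2) two_pos
  refine ⟨Φ.formW y y • x + (s - Φ.formW x y) • y, fun h => hy (hxy _ _ h).1, ?_⟩
  have hsymm : Φ.formW y x = Φ.formW x y := Φ.symm.eq y x
  simp only [map_add, map_smul, LinearMap.add_apply, LinearMap.smul_apply, smul_eq_mul, hsymm]
  linear_combination Φ.formW y y * hs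

/-- The rank one squares span `𝔰𝔭(V)`. -/
theorem eq_zero_of_square_eq_zero [FiniteDimensional ℂ V] (l : Dual ℂ Φ.sp)
    (h : ∀ a, l (Φ.square a) = 0) : l = 0 := by
  ext Y
  let b := finBasis ℂ V
  let b' := Φ.formV.dualBasis Φ.nondegV b
  have hb : ∀ i j, Φ.formV (b' i) (b j) = if j = i then 1 else 0 := fun i j =>
    Φ.formV.apply_dualBasis_left Φ.nondegV b i j
  -- Polarising `square` gives `v ↦ (x, v) y + (y, v) x`. With `x = b' i`, `y = Y (b i)`, each half
  -- sums to `Y`: one by duality of the bases, the other also by skew-adjointness.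
  have key : (2 : ℂ) • Y =
      ∑ i, (Φ.square (b' i + Y.1 (b i)) - Φ.square (b' i) - Φ.square (Y.1 (b i))) := by
    refine Subtype.ext (LinearMap.ext fun v => ?_)
    have h1 : Y.1 v = ∑ i, Φ.formV (Y.1 (b i)) v • b' i := by
      conv_lhs => rw [← b'.sum_repr (Y.1 v)]
      refine Finset.sum_congr rfl fun i _ => ?_
      rw [LinearMap.BilinForm.dualBasis_repr_apply, sp_apply, ← formV_swap]
    have h3 : v = ∑ i, Φ.formV (b' i) v • b i := by
      have h4 : ∀ i, Φ.formV (b' i) v = b.repr v i := fun i => by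
        conv_lhs => rw [← b.sum_repr v, map_sum]
        simp [hb]
      simp only [h4, b.sum_repr]
    have h2 : Y.1 v = ∑ i, Φ.formV (b' i) v • Y.1 (b i) := by
      conv_lhs => rw [h3]
      simp
    have h5 : ((2 : ℂ) • Y : Φ.sp).1 v = Y.1 v + Y.1 v := two_smul ℂ (Y.1 v)
    rw [h5]
    conv_lhs => rw [h1]
    nth_rewrite 2 [h1.symm.trans h2]
    rw [← Finset.sum_add_distrib, AddSubmonoidClass.coe_finsetSum, LinearMap.sum_apply]
    refine Finset.sum_congr rfl fun i _ => ?_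
    change _ = (Φ.square (b' i + Y.1 (b i))).1 v - (Φ.square (b' i)).1 v -
      (Φ.square (Y.1 (b i))).1 v
    simp only [square_apply, map_add, LinearMap.add_apply, smul_add, add_smul]
    abel
  have h2 : (2 : ℂ) • l Y = 0 := by
    rw [← map_smul, key]
    simp [h]
  simpa using h2

/-- `𝔭 ⊕ V` embeds into `𝔰𝔭(V)`, as `Λ²V ⊕ V` does into `S²V`. -/
theorem finrank_p_add_le [FiniteDimensional ℂ V] :
    finrank ℂ Φ.p + finrank ℂ V ≤ finrank ℂ Φ.sp := by
  let b := finBasis ℂ V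
  let b' := Φ.formV.dualBasis Φ.nondegV b
  have hb : ∀ i j, Φ.formV (b' i) (b j) = if j = i then 1 else 0 := fun i j =>
    Φ.formV.apply_dualBasis_left Φ.nondegV b i j
  -- A symmetric matrix: the above-diagonal entries of the alternating form `(X ·, ·)` are mirrored
  -- below, and the diagonal is free.
  let M : Φ.p × (Fin (finrank ℂ V) → ℂ) → Fin (finrank ℂ V) → Fin (finrank ℂ V) → ℂ :=
    fun x i j => if i < j then Φ.formV (x.1.1 (b i)) (b j) else
      if j < i then Φ.formV (x.1.1 (b j)) (b i) else x.2 i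
  let Y : Φ.p × (Fin (finrank ℂ V) → ℂ) → End ℂ V :=
    fun x => b.constr ℂ fun i => ∑ j, M x i j • b' j
  have hYb : ∀ x i, Y x (b i) = ∑ j, M x i j • b' j := fun x i => b.constr_basis ℂ _ i
  have hYM : ∀ x i j, Φ.formV (Y x (b i)) (b j) = M x i j := fun x i j => by
    rw [hYb]
    simp [hb]
  have hM : ∀ x i j, M x i j = M x j i := fun x i j => by
    rcases lt_trichotomy i j with h | rfl | h
    · simp [M, h, h.not_gt]
    · rfl
    · simp [M, h, h.not_gt]
  have hY : ∀ x, Y x ∈ Φ.sp := fun x => by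
    have h1 : Φ.formV ∘ₗ Y x = -(Φ.formV.compl₂ (Y x)) := by
      refine b.ext fun i => b.ext fun j => ?_
      change Φ.formV (Y x (b i)) (b j) = -Φ.formV (b i) (Y x (b j))
      rw [hYM, formV_swap Φ (b i), hYM, neg_neg, hM]
    rw [LinearMap.mem_skewAdjointSubmodule]
    intro u v
    have h2 := LinearMap.congr_fun (LinearMap.congr_fun h1 u) v
    exact h2.trans (map_neg (Φ.formV u) (Y x v)).symm
  let Ψ : Φ.p × (Fin (finrank ℂ V) → ℂ) →ₗ[ℂ] Φ.sp :=
    { toFun := fun x => ⟨Y x, hY x⟩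
      map_add' := fun x y => by
        refine Subtype.ext (b.ext fun i => ?_)
        change Y (x + y) (b i) = Y x (b i) + Y y (b i)
        simp only [hYb, ← Finset.sum_add_distrib, ← add_smul]
        refine Finset.sum_congr rfl fun j _ => congrArg (· • b' j) ?_
        simp only [M]
        split_ifs <;> simp
      map_smul' := fun c x => by
        refine Subtype.ext (b.ext fun i => ?_)
        change Y (c • x) (b i) = c • Y x (b i)
        simp only [hYb, Finset.smul_sum, smul_smul]
        refine Finset.sum_congr rfl fun j _ => congrArg (· • b' j) ?_
        simp only [M]
        split_ifs <;> simp }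
  have hinj : Function.Injective Ψ := by
    rw [← LinearMap.ker_eq_bot, LinearMap.ker_eq_bot']
    intro x hx
    have h0 : ∀ i j, M x i j = 0 := fun i j => by
      have h1 : Y x = 0 := congrArg Subtype.val hx
      rw [← hYM, h1]
      simp
    have hlt : ∀ i j, i < j → Φ.formV (x.1.1 (b i)) (b j) = 0 := fun i j h => by
      simpa [M, h] using h0 i j
    refine Prod.ext (Subtype.ext (b.ext fun i => Φ.nondegV.1 _ ?_))
      (funext fun i => by simpa [M] using h0 i i)
    have h2 : Φ.formV (x.1.1 (b i)) = 0 := by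
      refine b.ext fun j => ?_
      rcases lt_trichotomy i j with h | rfl | h
      · exact hlt i j h
      · have h3 := formV_swap Φ (x.1.1 (b i)) (b i)
        rw [← p_apply] at h3
        exact self_eq_neg.1 h3
      · rw [p_apply, formV_swap, hlt j i h]
        simp
    intro v
    rw [h2]
    rfl
  simpa [Module.finrank_prod] using LinearMap.finrank_le_finrank_of_injective hinj

/-- The linear subspace of the `(B, c, i)` with `c` a scalar and `i` a multiple of an isotropic
linear form. -/
def linearFamily (u : W) : Φ.p × ℂ × V →ₗ[ℂ] Φ.N :=
  LinearMap.id.prodMap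
    ((LinearMap.toSpanSingleton ℂ Φ.p ⟨1, by
      rw [LinearMap.mem_selfAdjointSubmodule]; exact fun _ _ => rfl⟩).prodMap (Φ.rankOne u))

theorem linearFamily_injective [Nontrivial V] {u : W} (hu : u ≠ 0) :
    Function.Injective (Φ.linearFamily u) := by
  rintro ⟨B, c, a⟩ ⟨B', c', a'⟩ h
  have hB : B = B' := congrArg (fun x => x.1) h
  have hc : c • (1 : End ℂ V) = c' • 1 := congrArg (fun x => x.2.1.1) h
  have ha : Φ.rankOne u a = Φ.rankOne u a' := congrArg (fun x => x.2.2) h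
  obtain ⟨w, hw⟩ : ∃ w, Φ.formW u w ≠ 0 := by
    by_contra! hc
    exact hu (Φ.nondegW.1 u hc)
  exact Prod.ext hB (Prod.ext (smul_left_injective ℂ one_ne_zero hc)
    (smul_right_injective V hw (LinearMap.congr_fun ha w)))

variable [FiniteDimensional ℂ W]

theorem mu_smul (t : ℂ) (x : Φ.N) : Φ.mu (t • x) = t ^ 2 • Φ.mu x := by
  ext v
  simp [mu, m, rho, Ring.lie_def, smul_smul, pow_two, smul_add, smul_sub]

theorem formW_star (i : W →ₗ[ℂ] V) (w : W) (v : V) :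
    Φ.formW w (Φ.star i v) = Φ.formV (i w) v :=
  apply_rightAdjoint Φ.formW Φ.nondegW Φ.formV i w v

theorem star_rankOne (u : W) (a v : V) : Φ.star (Φ.rankOne u a) v = Φ.formV a v • u := by
  refine sub_eq_zero.1 (Φ.nondegW.2 _ fun w => ?_)
  rw [map_sub, formW_star, rankOne_apply, map_smul, map_smul, LinearMap.smul_apply, Φ.symm.eq u w]
  simp [mul_comm]

theorem rho_rankOne_apply (u : W) (a v : V) :
    (Φ.rho (Φ.rankOne u a) : End ℂ V) v = (Φ.formW u u * Φ.formV a v) • a := by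
  change Φ.rankOne u a (Φ.star (Φ.rankOne u a) v) = _
  rw [star_rankOne, map_smul, rankOne_apply, smul_smul, mul_comm]

theorem mrho_linearFamily {u : W} (hu : Φ.formW u u = 0) (x : Φ.p × ℂ × V) :
    Φ.mrho (Φ.linearFamily u x) = 0 := by
  obtain ⟨B, c, a⟩ := x
  refine Prod.ext (Subtype.ext ?_) (Subtype.ext (LinearMap.ext fun v => ?_))
  · change (⁅B.1, c • (1 : End ℂ V)⁆ : End ℂ V) = 0
    simp [Ring.lie_def]
  · change (Φ.rho (Φ.rankOne u a) : End ℂ V) v = 0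
    rw [rho_rankOne_apply, hu, zero_mul, zero_smul]

variable [FiniteDimensional ℂ V]

/-- For anisotropic `u`, the value of `μ` at `(0, 0, (u, ·) a)` is a nonzero multiple of `a²`, and
these squares span `𝔰𝔭(V)`. -/
theorem eq_zero_of_comp_mu_eq_zero [Nontrivial W] (l : Dual ℂ Φ.sp) (h : ∀ x, l (Φ.mu x) = 0) :
    l = 0 := by
  obtain ⟨u, hu⟩ := Φ.exists_formW_self_ne_zero
  refine Φ.eq_zero_of_square_eq_zero l fun a => ?_
  have h1 := h (0, 0, Φ.rankOne u a)
  have h2 : Φ.mu (0, 0, Φ.rankOne u a) = Φ.formW u u • Φ.square a := by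
    ext v
    have h0 : (⁅(0 : End ℂ V), (0 : End ℂ V)⁆ : End ℂ V) v = 0 := by simp [Ring.lie_def]
    change (⁅(0 : End ℂ V), (0 : End ℂ V)⁆ : End ℂ V) v + (Φ.rho (Φ.rankOne u a) : End ℂ V) v =
      Φ.formW u u • (Φ.square a : End ℂ V) v
    rw [rho_rankOne_apply, square_apply, smul_smul, h0, zero_add]
  rw [h2, map_smul, smul_eq_mul] at h1
  exact (mul_eq_zero.1 h1).resolve_left hu

/-- The map `mu` is `mrho` followed by addition on `𝔰𝔭(V)`, so pullbacks along `mu` factor through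
`mrho`. -/
theorem muIdeal_le_mrhoIdeal : Φ.muIdeal ≤ Φ.mrhoIdeal := by
  refine Ideal.map_le_iff_le_comap.2 fun g hg => ?_
  let s : Φ.sp × Φ.sp →ₗ[ℂ] Φ.sp := LinearMap.fst ℂ _ _ + LinearMap.snd ℂ _ _
  refine Ideal.mem_map_of_mem (comorphism Φ.mrho Φ.isPolyMap_mrho)
    (x := comorphism s (isPolyMap_linear s) g) ?_
  change g.1 (s 0) = 0
  rw [map_zero]
  exact hg

/-- The scalar direction of `linearFamily` supplies the extra 1 that makes the dimension count
strict. -/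
theorem exists_subspace_mrho_eq_zero [Nontrivial V] (hW : finrank ℂ W = 2) :
    ∃ L : Submodule ℂ Φ.N, (∀ x ∈ L, Φ.mrho x = 0) ∧
      finrank ℂ Φ.N < finrank ℂ L + finrank ℂ Φ.sp := by
  obtain ⟨u, hu, huu⟩ := Φ.exists_isotropic hW.ge
  refine ⟨LinearMap.range (Φ.linearFamily u), ?_, ?_⟩
  · rintro _ ⟨x, rfl⟩
    exact Φ.mrho_linearFamily huu x
  · rw [LinearMap.finrank_range_of_inj (Φ.linearFamily_injective hu)]
    have h1 := Φ.finrank_p_add_le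
    have h2 : finrank ℂ Φ.N = finrank ℂ Φ.p + (finrank ℂ Φ.p + 2 * finrank ℂ V) := by
      rw [Module.finrank_prod, Module.finrank_prod, Module.finrank_linearMap, hW]
    have h3 : finrank ℂ (Φ.p × ℂ × V) = finrank ℂ Φ.p + (1 + finrank ℂ V) := by
      rw [Module.finrank_prod, Module.finrank_prod, Module.finrank_self]
    omega

theorem mrhoIdeal_le_subspaceIdeal {L : Submodule ℂ Φ.N} (hL : ∀ x ∈ L, Φ.mrho x = 0) :
    Φ.mrhoIdeal ≤ subspaceIdeal L := by
  refine Ideal.map_le_iff_le_comap.2 fun g hg => mem_subspaceIdeal.2 fun x hx => ?_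
  change g.1 (Φ.mrho x) = 0
  rw [hL x hx]
  exact hg

theorem fibre_dimension [Nontrivial V] (hW : finrank ℂ W = 2) :
      ¬ IsCompleteIntersection Φ.muIdeal ∧
      ¬ IsFlatMorphism Φ.mu Φ.isPolyMap_mu ∧
      Φ.muIdeal ≤ Φ.mrhoIdeal ∧
      (finrank ℂ Φ.N : WithBot ℕ∞) <
        ringKrullDim (coordRing Φ.N ⧸ Φ.mrhoIdeal) + finrank ℂ Φ.sp := by
  have : Nontrivial W := Module.nontrivial_of_finrank_pos (R := ℂ) (by omega)
  obtain ⟨L, hL, hlt⟩ := Φ.exists_subspace_mrho_eq_zero hW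
  have hle := Φ.mrhoIdeal_le_subspaceIdeal hL
  refine ⟨?_, fun h => ?_, Φ.muIdeal_le_mrhoIdeal, ?_⟩
  · rintro ⟨s, hs, hd⟩
    have h1 := finrank_le_card_of_span_eq_fibreIdeal Φ.mu_smul Φ.eq_zero_of_comp_mu_eq_zero hs
    have h2 := finrank_le_ringKrullDim_quotient (Φ.muIdeal_le_mrhoIdeal.trans hle)
    have h3 : ((finrank ℂ L + s.card : ℕ) : WithBot ℕ∞) ≤ (finrank ℂ Φ.N : ℕ) := by
      rw [← ringKrullDim_coordRing, ← hd, Nat.cast_add]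
      exact add_le_add h2 le_rfl
    have h4 : finrank ℂ L + s.card ≤ finrank ℂ Φ.N := by exact_mod_cast h3
    omega
  · have h1 := finrank_add_finrank_le_of_isFlatMorphism h (L := L) fun x hx => by
      have h2 := hL x hx
      change (Φ.mrho x).1 + (Φ.mrho x).2 = 0
      rw [h2]
      exact add_zero 0
    omega
  · refine lt_of_lt_of_le ?_ (add_le_add (finrank_le_ringKrullDim_quotient hle) le_rfl)
    exact_mod_cast hlt

end SOForms

/-! ### Pfaffian identities for alternating 4 × 4 matrices. -/

section AlternatingMatrices

/-- The alternating `4 × 4` matrix with the given entries above the diagonal. -/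
def altMatrix (a b c d e f : ℂ) : Matrix (Fin 4) (Fin 4) ℂ :=
  !![0, a, b, c; -a, 0, d, e; -b, -d, 0, f; -c, -e, -f, 0]

/-- The Hodge dual of an alternating `4 × 4` matrix. -/
def hodgeDual (M : Matrix (Fin 4) (Fin 4) ℂ) : Matrix (Fin 4) (Fin 4) ℂ :=
  altMatrix (M 2 3) (-M 1 3) (M 1 2) (M 0 3) (-M 0 2) (M 0 1)

/-- The polarisation of the Pfaffian of `4 × 4` matrices. -/
def pfaffianPolar (M N : Matrix (Fin 4) (Fin 4) ℂ) : ℂ :=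
  M 0 1 * N 2 3 + N 0 1 * M 2 3 - M 0 2 * N 1 3 - N 0 2 * M 1 3 + M 0 3 * N 1 2 + N 0 3 * M 1 2

theorem eq_altMatrix {M : Matrix (Fin 4) (Fin 4) ℂ} (hM : ∀ i j, M i j = -M j i) :
    M = altMatrix (M 0 1) (M 0 2) (M 0 3) (M 1 2) (M 1 3) (M 2 3) := by
  have h0 : ∀ i, M i i = 0 := fun i => self_eq_neg.1 (hM i i)
  ext i j
  fin_cases i <;> fin_cases j <;> first | exact h0 _ | exact hM _ _ | rfl

theorem mul_hodgeDual_add {M N : Matrix (Fin 4) (Fin 4) ℂ} (hM : ∀ i j, M i j = -M j i)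
    (hN : ∀ i j, N i j = -N j i) :
    M * hodgeDual N + N * hodgeDual M = -pfaffianPolar M N • (1 : Matrix (Fin 4) (Fin 4) ℂ) := by
  rw [eq_altMatrix hM, eq_altMatrix hN]
  generalize M 0 1 = a, M 0 2 = b, M 0 3 = c, M 1 2 = d, M 1 3 = e, M 2 3 = f
  generalize N 0 1 = a', N 0 2 = b', N 0 3 = c', N 1 2 = d', N 1 3 = e', N 2 3 = f'
  ext i j
  fin_cases i <;> fin_cases j <;>
    simp [altMatrix, hodgeDual, pfaffianPolar] <;> ring

theorem mul_hodgeDual_self {M : Matrix (Fin 4) (Fin 4) ℂ} (hM : ∀ i j, M i j = -M j i) :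
    M * hodgeDual M = -(pfaffianPolar M M / 2) • (1 : Matrix (Fin 4) (Fin 4) ℂ) := by
  have h := mul_hodgeDual_add hM hM
  rw [← two_smul ℂ] at h
  rw [← inv_smul_smul₀ (two_ne_zero' ℂ) (M * hodgeDual M), h, smul_smul]
  congr 1
  ring

/-- If the Pfaffian vanished, `M * hodgeDual M = 0` with `M` invertible would kill the dual, whose
entries are those of `M` up to sign and position. -/
theorem pfaffianPolar_self_ne_zero {M : Matrix (Fin 4) (Fin 4) ℂ} (hM : ∀ i j, M i j = -M j i)
    (hdet : M.det ≠ 0) : pfaffianPolar M M ≠ 0 := by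
  intro h
  have h1 := mul_hodgeDual_self hM
  rw [h, zero_div, neg_zero, zero_smul] at h1
  have h2 : hodgeDual M = 0 := by
    rw [← Matrix.nonsing_inv_mul_cancel_left M (hodgeDual M) (isUnit_iff_ne_zero.2 hdet), h1,
      mul_zero]
  have h3 : ∀ i j, hodgeDual M i j = 0 := fun i j => by rw [h2]; rfl
  refine hdet ?_
  have h01 : M 0 1 = 0 := h3 2 3
  have h02 : M 0 2 = 0 := by simpa [hodgeDual, altMatrix] using h3 1 3
  have h03 : M 0 3 = 0 := h3 1 2
  have h12 : M 1 2 = 0 := h3 0 3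
  have h13 : M 1 3 = 0 := by simpa [hodgeDual, altMatrix] using h3 0 2
  have h23 : M 2 3 = 0 := h3 0 1
  have h4 : M = 0 := by
    rw [eq_altMatrix hM, h01, h02, h03, h12, h13, h23]
    ext i j
    fin_cases i <;> fin_cases j <;> simp [altMatrix]
  rw [h4, Matrix.det_zero]

/-- A matrix which is self-adjoint for a nondegenerate alternating form satisfies the quadratic
equation given by the Pfaffian. -/
theorem sq_eq_of_alternating {J Y : Matrix (Fin 4) (Fin 4) ℂ} (hJ : ∀ i j, J i j = -J j i)
    (hdet : J.det ≠ 0) (hY : ∀ i j, (Y * J) i j = -(Y * J) j i) :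
    Y * Y = (2 * pfaffianPolar (Y * J) J / pfaffianPolar J J) • Y +
      -(pfaffianPolar (Y * J) (Y * J) / pfaffianPolar J J) • (1 : Matrix (Fin 4) (Fin 4) ℂ) := by
  have hp := pfaffianPolar_self_ne_zero hJ hdet
  -- Multiplying the polarised identity for `Y * J` and `J` by `Y` makes `J * hodgeDual J` and `(Y *
  -- J) * hodgeDual (Y * J)` appear, both scalar.
  have h1 := congrArg (Y * ·) (mul_hodgeDual_add hY hJ)
  simp only [mul_add, Matrix.mul_assoc Y J, mul_hodgeDual_self hJ, mul_smul_comm, mul_one] at h1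
  rw [← Matrix.mul_assoc Y J, mul_hodgeDual_self hY] at h1
  have h2 : (pfaffianPolar J J / 2) • (Y * Y) = pfaffianPolar (Y * J) J • Y +
      -(pfaffianPolar (Y * J) (Y * J) / 2) • (1 : Matrix (Fin 4) (Fin 4) ℂ) := by
    linear_combination (norm := module) -h1
  rw [← inv_smul_smul₀ (div_ne_zero hp (two_ne_zero' ℂ)) (Y * Y), h2, smul_add, smul_smul,
    smul_smul]
  congr 2 <;> field_simp

end AlternatingMatrices

/-! ### Absence of stable points in the zero fibre for `dim V = 4`. -/

namespace SOForms

variable {V W : Type*} [AddCommGroup V] [Module ℂ V] [AddCommGroup W] [Module ℂ W]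
  (Φ : SOForms V W)

/-- The Pfaffian equation applied to the transposed matrix of `X`, since `(X ·, ·)` is alternating.
Linearity of `τ` is essential: it makes the completion of squares below compatible with addition. -/
theorem exists_sq_eq [FiniteDimensional ℂ V] (hV : finrank ℂ V = 4) :
    ∃ τ : Φ.p →ₗ[ℂ] ℂ, ∀ X : Φ.p, ∃ d : ℂ, X.1 * X.1 = τ X • X.1 + d • 1 := by
  let b := finBasisOfFinrankEq ℂ V hV
  let J : Matrix (Fin 4) (Fin 4) ℂ := LinearMap.BilinForm.toMatrix b Φ.formV
  have hJ : ∀ i j, J i j = -J j i := fun i j => by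
    simp only [J, LinearMap.BilinForm.toMatrix_apply]
    exact Φ.formV_swap _ _
  have hdet : J.det ≠ 0 := (LinearMap.BilinForm.nondegenerate_iff_det_ne_zero b).1 Φ.nondegV
  let T : Φ.p →ₗ[ℂ] Matrix (Fin 4) (Fin 4) ℂ := (LinearMap.toMatrix b b).toLinearMap ∘ₗ Φ.p.subtype
  have hT : ∀ X i j, ((T X).transpose * J) i j = Φ.formV (X.1 (b i)) (b j) := fun X i j => by
    conv_rhs => rw [← b.sum_repr (X.1 (b i)), map_sum, LinearMap.sum_apply]
    simp only [map_smul, LinearMap.smul_apply]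
    simp [Matrix.mul_apply, T, J, LinearMap.toMatrix_apply, LinearMap.BilinForm.toMatrix_apply]
  let τ : Φ.p →ₗ[ℂ] ℂ :=
    { toFun := fun X => 2 * pfaffianPolar ((T X).transpose * J) J / pfaffianPolar J J
      map_add' := fun X Y => by
        simp only [map_add, Matrix.transpose_add, add_mul, pfaffianPolar, Matrix.add_apply]
        ring
      map_smul' := fun c X => by
        simp only [map_smul, Matrix.transpose_smul, smul_mul_assoc, pfaffianPolar,
          Matrix.smul_apply, smul_eq_mul, RingHom.id_apply]
        ring }
  refine ⟨τ, fun X => ⟨-(pfaffianPolar ((T X).transpose * J) ((T X).transpose * J) /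
    pfaffianPolar J J), ?_⟩⟩
  have h1 := congrArg Matrix.transpose (sq_eq_of_alternating hJ hdet (Y := (T X).transpose)
    fun i j => by rw [hT, hT, Φ.p_apply, ← formV_swap])
  apply (LinearMap.toMatrix b b).injective
  rw [LinearMap.toMatrix_mul]
  simp only [map_add, map_smul, LinearMap.toMatrix_one]
  simp only [Matrix.transpose_mul, Matrix.transpose_transpose, Matrix.transpose_add,
    Matrix.transpose_smul, Matrix.transpose_one] at h1
  exact h1

/-- In dimension four, self-adjoint endomorphisms satisfy Clifford relations up to scalars. -/
theorem exists_clifford [FiniteDimensional ℂ V] (hV : finrank ℂ V = 4) (X Y : Φ.p) :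
    ∃ x y c d s : ℂ, (X.1 - x • 1) * (X.1 - x • 1) = c • 1 ∧ (Y.1 - y • 1) * (Y.1 - y • 1) = d • 1 ∧
      (X.1 - x • 1) * (Y.1 - y • 1) + (Y.1 - y • 1) * (X.1 - x • 1) = s • 1 := by
  obtain ⟨τ, hτ⟩ := Φ.exists_sq_eq hV
  have h : ∀ X : Φ.p, ∃ c : ℂ, (X.1 - (τ X / 2) • 1) * (X.1 - (τ X / 2) • 1) = c • 1 := fun X => by
    obtain ⟨d, hd⟩ := hτ X
    refine ⟨d + τ X ^ 2 / 4, ?_⟩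
    simp only [sub_mul, mul_sub, hd, smul_mul_assoc, mul_smul_comm, one_mul, mul_one]
    module
  obtain ⟨c, hc⟩ := h X
  obtain ⟨d, hd⟩ := h Y
  -- Polarisation: the trace-like shift of `X + Y` is the sum of the two shifts, so the
  -- anticommutator is scalar.
  obtain ⟨e, he⟩ := h (X + Y)
  refine ⟨τ X / 2, τ Y / 2, c, d, e - c - d, hc, hd, ?_⟩
  have h1 : (X + Y).1 - (τ (X + Y) / 2) • (1 : End ℂ V) =
      (X.1 - (τ X / 2) • 1) + (Y.1 - (τ Y / 2) • 1) := by
    rw [map_add, Submodule.coe_add]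
    module
  rw [h1, add_mul, mul_add, mul_add, hc, hd] at he
  rw [sub_smul, sub_smul, ← he]
  abel

variable [FiniteDimensional ℂ W]

/-- A functional `(w, ·)` vanishing on the image of `i*` satisfies `(i w, v) = 0` for all `v`, hence
`i w = 0` and `w = 0`. -/
theorem star_surjective {i : W →ₗ[ℂ] V} (hi : Function.Injective i) :
    Function.Surjective (Φ.star i) := by
  rw [← LinearMap.range_eq_top]
  by_contra hne
  obtain ⟨l, hl, hr⟩ := Submodule.exists_le_ker_of_lt_top _ (lt_top_iff_ne_top.2 hne)
  obtain ⟨w, rfl⟩ := (LinearMap.BilinForm.toDual Φ.formW Φ.nondegW).surjective l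
  have h0 : w = 0 := by
    refine hi ?_
    rw [map_zero]
    refine Φ.nondegV.1 _ fun v => ?_
    rw [← formW_star]
    exact hr ⟨v, rfl⟩
  exact hl (by rw [h0, map_zero])

/-- Anticommutation turns the commutator into `-2 Z X`, so `i i*` is a multiple of `Z X`. If `i` is
injective, `i*` is onto and `Im i ⊆ Im Z`, which is invariant and proper since `Z² = 0`. Otherwise
`Im i` lies on a line `ℂ a`, and `Z X a` returns to that line, so `a`, `X a`, `Z a` span an
invariant subspace of dimension at most 3. -/
theorem exists_invariant_of_anticommute [FiniteDimensional ℂ V] (hV : finrank ℂ V = 4)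
    (hW : finrank ℂ W = 2) {X Z : End ℂ V} {i : W →ₗ[ℂ] V} {c ε : ℂ} (hX : X * X = c • 1)
    (hZ : Z * Z = 0) (hXZ : X * Z = -(Z * X)) (hε : ε ≠ 0)
    (h : X * Z - Z * X = ε • (i ∘ₗ Φ.star i : End ℂ V)) :
    ∃ S : Submodule ℂ V, S ≠ ⊤ ∧ S.map X ≤ S ∧ S.map Z ≤ S ∧ LinearMap.range i ≤ S := by
  have hX' : ∀ v, X (X v) = c • v := fun v => LinearMap.congr_fun hX v
  have hZ' : ∀ v, Z (Z v) = 0 := fun v => LinearMap.congr_fun hZ v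
  have hXZ' : ∀ v, X (Z v) = -Z (X v) := fun v => LinearMap.congr_fun hXZ v
  have hC : ∀ v, i (Φ.star i v) = (-2 * ε⁻¹) • Z (X v) := fun v => by
    have h1 : X (Z v) - Z (X v) = ε • i (Φ.star i v) := LinearMap.congr_fun h v
    rw [← inv_smul_smul₀ hε (i (Φ.star i v)), ← h1, hXZ']
    module
  by_cases hi : Function.Injective i
  · refine ⟨LinearMap.range Z, fun htop => ?_, ?_, ?_, ?_⟩
    · have h1 : LinearMap.range Z ≤ LinearMap.ker Z := by
        rintro _ ⟨v, rfl⟩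
        exact hZ' v
      have h2 := LinearMap.finrank_range_add_finrank_ker Z
      rw [htop, top_le_iff] at h1
      rw [htop, h1, finrank_top] at h2
      omega
    · rintro _ ⟨_, ⟨v, rfl⟩, rfl⟩
      rw [hXZ', ← map_neg]
      exact ⟨_, rfl⟩
    · rintro _ ⟨_, ⟨v, rfl⟩, rfl⟩
      exact ⟨_, rfl⟩
    · rintro _ ⟨w, rfl⟩
      obtain ⟨v, rfl⟩ := Φ.star_surjective hi w
      rw [hC, ← map_smul]
      exact ⟨_, rfl⟩
  · obtain ⟨a, ha⟩ : ∃ a, LinearMap.range i ≤ Submodule.span ℂ {a} := by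
      have h1 : finrank ℂ (LinearMap.range i) ≤ 1 := by
        have h2 := LinearMap.finrank_range_add_finrank_ker i
        have h3 : 0 < finrank ℂ (LinearMap.ker i) := by
          rw [Module.finrank_pos_iff_of_free, Submodule.nontrivial_iff_ne_bot]
          exact fun h => hi (LinearMap.ker_eq_bot.1 h)
        omega
      obtain ⟨a, ha⟩ := (Submodule.finrank_le_one_iff_isPrincipal _).1 h1
      exact ⟨a, ha.le⟩
    have hs : ∀ x ∈ ({a, X a, Z a} : Set V), x ∈ Submodule.span ℂ {a, X a, Z a} :=
      fun x hx => Submodule.subset_span hx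
    have hZX : Z (X a) ∈ Submodule.span ℂ {a, X a, Z a} := by
      have h1 : Z (X a) = (-2 * ε⁻¹)⁻¹ • i (Φ.star i a) := by
        rw [hC, inv_smul_smul₀ (mul_ne_zero (by norm_num) (inv_ne_zero hε))]
      rw [h1]
      refine Submodule.smul_mem _ _ (Submodule.span_mono (by simp) (ha ⟨_, rfl⟩))
    refine ⟨Submodule.span ℂ {a, X a, Z a}, fun htop => ?_, ?_, ?_, ?_⟩
    · classical
      have h1 := finrank_span_finset_le_card (R := ℂ) ({a, X a, Z a} : Finset V)
      have h2 : (({a, X a, Z a} : Finset V) : Set V) = {a, X a, Z a} := by simp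
      rw [Set.finrank, h2, htop, finrank_top, hV] at h1
      have h3 := Finset.card_le_three (a := a) (b := X a) (c := Z a)
      omega
    · rw [Submodule.map_span_le]
      rintro _ (rfl | rfl | rfl)
      · exact hs _ (by simp)
      · rw [hX']
        exact Submodule.smul_mem _ _ (hs _ (by simp))
      · rw [hXZ']
        exact Submodule.neg_mem _ hZX
    · rw [Submodule.map_span_le]
      rintro _ (rfl | rfl | rfl)
      · exact hs _ (by simp)
      · exact hZX
      · rw [hZ']
        exact Submodule.zero_mem _
    · exact ha.trans (Submodule.span_mono (by simp))

theorem exists_invariant_of_mu_eq_zero [FiniteDimensional ℂ V] (hV : finrank ℂ V = 4)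
    (hW : finrank ℂ W = 2) {x : Φ.N} (hx : Φ.mu x = 0) :
    ∃ S : Submodule ℂ V, S ≠ ⊤ ∧ S.map x.1.1 ≤ S ∧ S.map x.2.1.1 ≤ S ∧
      LinearMap.range x.2.2 ≤ S := by
  obtain ⟨X, Y, i⟩ := x
  obtain ⟨x, y, c, d, s, hX, hY, hXY⟩ := Φ.exists_clifford hV X Y
  have hμ : X.1 * Y.1 - Y.1 * X.1 + i ∘ₗ Φ.star i = 0 := congrArg Subtype.val hx
  have hcomm : (X.1 - x • 1) * (Y.1 - y • 1) - (Y.1 - y • 1) * (X.1 - x • 1) =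
      -(i ∘ₗ Φ.star i : End ℂ V) := by
    rw [← eq_neg_of_add_eq_zero_left hμ]
    simp only [sub_mul, mul_sub, smul_mul_assoc, mul_smul_comm, one_mul, mul_one]
    module
  have hXS : ∀ S : Submodule ℂ V, S.map (X.1 - x • 1) ≤ S → S.map X.1 ≤ S := by
    rintro S hS _ ⟨v, hv, rfl⟩
    have h1 : X.1 v = (X.1 - x • 1) v + x • v := by simp
    rw [h1]
    exact S.add_mem (hS ⟨v, hv, rfl⟩) (S.smul_mem _ hv)
  have hYS : ∀ S : Submodule ℂ V, S.map (Y.1 - y • 1) ≤ S → S.map Y.1 ≤ S := by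
    rintro S hS _ ⟨v, hv, rfl⟩
    have h1 : Y.1 v = (Y.1 - y • 1) v + y • v := by simp
    rw [h1]
    exact S.add_mem (hS ⟨v, hv, rfl⟩) (S.smul_mem _ hv)
  generalize X.1 - x • 1 = P at *
  generalize Y.1 - y • 1 = Q at *
  -- The squared commutator is this scalar, but the commutator is `-i i*`, which kills a nonzero
  -- vector because `dim W < dim V`.
  have hdisc : s ^ 2 - 4 * c * d = 0 := by
    obtain ⟨v, hv, hv0⟩ : ∃ v ∈ LinearMap.ker (Φ.star i), v ≠ 0 :=
      Submodule.exists_mem_ne_zero_of_ne_bot (LinearMap.ker_ne_bot_of_finrank_lt (by omega))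
    have hsq : (P * Q - Q * P) * (P * Q - Q * P) = (s ^ 2 - 4 * c * d) • 1 := by
      have hQP : Q * P = s • 1 - P * Q := eq_sub_of_add_eq' hXY
      have h1 : P * Q * (P * Q) = s • (P * Q) - (c * d) • 1 := by
        calc P * Q * (P * Q) = P * (Q * P) * Q := by simp only [mul_assoc]
          _ = s • (P * Q) - (P * P) * (Q * Q) := by
            rw [hQP, mul_sub, sub_mul, mul_smul_comm, mul_one, smul_mul_assoc]
            simp only [mul_assoc]
          _ = _ := by rw [hX, hY, smul_mul_smul_comm, one_mul]
      rw [hQP]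
      simp only [sub_mul, mul_sub, h1, smul_mul_assoc, mul_smul_comm, one_mul, mul_one]
      module
    have h2 := LinearMap.congr_fun hsq v
    rw [hcomm] at h2
    have h3 : Φ.star i v = 0 := hv
    simp only [Module.End.mul_apply, LinearMap.neg_apply, LinearMap.comp_apply, h3, map_zero,
      neg_zero] at h2
    exact (smul_eq_zero.1 h2.symm).resolve_right hv0
  -- The form `(αP + βQ)² = cα² + sαβ + dβ²` is degenerate; `Z` is taken in its radical: `P` if `c =
  -- 0` (then `s = 0`), otherwise `Q - (s / 2c) P`.
  by_cases hc : c = 0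
  · have hs : s = 0 := by simpa [hc] using hdisc
    rw [hc, zero_smul] at hX
    rw [hs, zero_smul] at hXY
    obtain ⟨S, hS, h1, h2, h3⟩ := Φ.exists_invariant_of_anticommute hV hW (i := i) (ε := 1) hY hX
      (eq_neg_of_add_eq_zero_right hXY) one_ne_zero (by rw [one_smul, ← neg_sub, hcomm, neg_neg])
    exact ⟨S, hS, hXS S h2, hYS S h1, h3⟩
  · have hZ : (Q - (s / (2 * c)) • P) * (Q - (s / (2 * c)) • P) = 0 := by
      have h1 : (Q - (s / (2 * c)) • P) * (Q - (s / (2 * c)) • P) =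
          (Q * Q) - (s / (2 * c)) • (P * Q + Q * P) + (s / (2 * c)) ^ 2 • (P * P) := by
        simp only [sub_mul, mul_sub, smul_mul_assoc, mul_smul_comm]
        module
      rw [h1, hX, hY, hXY, smul_smul, smul_smul, ← sub_smul, ← add_smul]
      have h2 : d - s / (2 * c) * s + (s / (2 * c)) ^ 2 * c = 0 := by
        field_simp
        linear_combination -hdisc
      rw [h2, zero_smul]
    obtain ⟨S, hS, h1, h2, h3⟩ := Φ.exists_invariant_of_anticommute hV hW (i := i) (ε := -1)
      (X := P) (Z := Q - (s / (2 * c)) • P) hX hZ (by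
        rw [eq_neg_iff_add_eq_zero]
        simp only [sub_mul, mul_sub, smul_mul_assoc, mul_smul_comm]
        have h2 : P * Q - (s / (2 * c)) • (P * P) + (Q * P - (s / (2 * c)) • (P * P)) =
          (P * Q + Q * P) - (s / (2 * c) * 2) • (P * P) := by module
        rw [h2, hXY, hX, smul_smul, ← sub_smul]
        have h3 : s - s / (2 * c) * 2 * c = 0 := by
          field_simp
          ring
        rw [h3, zero_smul]) (by norm_num) (by
        rw [neg_one_smul, ← hcomm]
        simp only [sub_mul, mul_sub, smul_mul_assoc, mul_smul_comm]
        abel)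
    refine ⟨S, hS, hXS S h1, hYS S ?_, h3⟩
    rintro _ ⟨v, hv, rfl⟩
    have h4 : Q v = (Q - (s / (2 * c)) • P) v + (s / (2 * c)) • P v := by simp
    rw [h4]
    exact S.add_mem (h2 ⟨v, hv, rfl⟩) (S.smul_mem _ (h1 ⟨v, hv, rfl⟩))

theorem regularLocus_eq_empty [FiniteDimensional ℂ V] (hV : finrank ℂ V = 4)
    (hW : finrank ℂ W = 2) : Φ.regularLocus = ∅ :=
  Set.eq_empty_of_forall_notMem fun _ hx => hx.2.1 (Φ.exists_invariant_of_mu_eq_zero hV hW hx.1)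

end SOForms

end

theorem mainTheorem5 {V W : Type*} [AddCommGroup V] [Module ℂ V] [FiniteDimensional ℂ V]
    [AddCommGroup W] [Module ℂ W] [FiniteDimensional ℂ W] (Φ : SOForms V W)
    (hN : Module.finrank ℂ W = 2) :
    (2 ≤ Module.finrank ℂ V →
      ¬ IsCompleteIntersection Φ.muIdeal ∧
      ¬ IsFlatMorphism Φ.mu Φ.isPolyMap_mu ∧
      Φ.muIdeal ≤ Φ.mrhoIdeal ∧
      (Module.finrank ℂ Φ.N : WithBot ℕ∞) <
        ringKrullDim (coordRing Φ.N ⧸ Φ.mrhoIdeal) + Module.finrank ℂ Φ.sp) ∧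
    (Module.finrank ℂ V = 4 → Φ.regularLocus = ∅) := by
  refine ⟨fun hV => ?_, fun hV => Φ.regularLocus_eq_empty hV hN⟩
  have : Nontrivial V := Module.nontrivial_of_finrank_pos (R := ℂ) (by omega)
  exact Φ.fibre_dimension hN
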